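/- Let $\Lambda$ be an ordered abelian group (totally ordered), $\mathrm{Aut}^+(\Lambda)$ the group of its order-preserving group automorphisms, $G$ a group, and $\alpha:G\to\mathrm{Aut}^+(\Lambda)$, $g\mapsto\alpha_g$, a homomorphism. A $\Lambda$-metric on a set $X$ is a map $d:X\times X\to\Lambda$ satisfying the usual axioms of a metric. A segment in $X$ with endpoints $x,y$ is the image of a distance-preserving map $\varphi:[a,b]\to X$, where $a\le b$ in $\Lambda$, $[a,b]=\{\lambda\in\Lambda: a\le\lambda\le b\}$, $\varphi(a)=x$ and $\varphi(b)=y$. A $\Lambda$-tree is a $\Lambda$-metric space in which (i) any two points are the endpoints of a segment; (ii) if two segments meet in exactly one point and it is an endpoint of both, then their union is a segment; (iii) the intersection of two segments with a common endpoint is a segment. A subset of a $\Lambda$-tree is a subtree if it contains every segment joining two of its points; the subtree spanned by a subset is the smallest subtree containing it. An action of $G$ on a $\Lambda$-tree $(X,d)$ is $\alpha$-affine if $d(gx,gy)=\alpha_g(d(x,y))$ for all $g\in G$ and $x,y\in X$. For a function $L:G\to\Lambda$ put $\mathbf c(g,h)=\tfrac12\bigl(L(g)+L(h)-\alpha_g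 L(g^{-1}h)\bigr)$, an element of the divisible hull $\mathbb Q\otimes\Lambda$ (with the order extending that of $\Lambda$). Call $L$ an $\alpha$-affine Lyndon length function if for all $g,h,k\in G$: (L1) $\mathbf c(g,h)\in\Lambda$; (L2) $L(1)=0$; (L3) $L(g)=\alpha_g(L(g^{-1}))$; (L4) $\mathbf c(g,h)<\mathbf c(g,k)$ implies $\mathbf c(g,h)=\mathbf c(h,k)$. (1) Given an $\alpha$-affine action of $G$ on a $\Lambda$-tree $(X,d)$ and a point $x\in X$, the function $L_x(g)=d(x,gx)$ is an $\alpha$-affine Lyndon length function on $G$. (2) Conversely, for every $\alpha$-affine Lyndon length function $L:G\to\Lambda$ there are a $\Lambda$-tree $(X,d)$ with an $\alpha$-affine action of $G$ and a point $x\in X$ such that $L=L_x$, and these are essentially unique in the following sense: $X$ is spanned by the orbit $Gx$, and whenever $(Z,d'')$ is a $\Lambda$-tree with an $\alpha$-affine action of $G$ and $z\in Z$ satisfies $L=L_z$, there is a unique $G$-equivariant distance-preserving map $\mu:X\to Z$ with $\mu(x)=z$, and the image of $\mu$ is the subtree of $Z$ spanned by the orbit $Gz$. -/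

import Mathlib

universe u v w

/-- `Aut⁺(Λ)`: the group (under composition) of all order-preserving group automorphisms of `Λ`,
that is, of all additive order automorphisms. -/
def OrderAddAut (Λ : Type*) [AddCommGroup Λ] [LinearOrder Λ] : Subgroup (Λ ≃o Λ) where
  carrier := {f | ∀ a b : Λ, f (a + b) = f a + f b}
  mul_mem' := by
    intro f g hf hg a b
    rw [RelIso.mul_apply, RelIso.mul_apply, RelIso.mul_apply, hg, hf]
  one_mem' := fun _ _ => rfl
  inv_mem' := by
    intro f hf a b
    apply f.injective
    rw [hf, RelIso.apply_inv_self, RelIso.apply_inv_self, RelIso.apply_inv_self]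

/-- The value `α_g(a)` of the order automorphism `α_g` of `Λ` at `a`. -/
def twist {Λ G : Type*} [AddCommGroup Λ] [LinearOrder Λ] [Group G]
    (α : G →* OrderAddAut Λ) (g : G) (a : Λ) : Λ :=
  (α g : Λ ≃o Λ) a

/-- A `Λ`-metric on `X`. -/
structure LambdaMetric (Λ X : Type*) [AddCommGroup Λ] [LinearOrder Λ] where
  dist : X → X → Λ
  dist_nonneg : ∀ x y, 0 ≤ dist x y
  dist_eq_zero : ∀ x y, dist x y = 0 ↔ x = y
  dist_comm : ∀ x y, dist x y = dist y x
  dist_triangle : ∀ x y z, dist x z ≤ dist x y + dist y z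

namespace LambdaMetric

section Trees

variable {Λ X : Type*} [AddCommGroup Λ] [LinearOrder Λ]

/-- `S` is a segment with endpoints `x` and `y`: the image of an isometry `φ : [a, b] → X`,
where `[a, b]` is a closed interval of `Λ`, with `φ a = x` and `φ b = y`. (Only the values of
`φ` on `[a, b]` matter.) -/
def IsSegment (d : LambdaMetric Λ X) (S : Set X) (x y : X) : Prop :=
  ∃ (a b : Λ) (φ : Λ → X), a ≤ b ∧
    (∀ s ∈ Set.Icc a b, ∀ t ∈ Set.Icc a b, d.dist (φ s) (φ t) = |s - t|) ∧
    φ a = x ∧ φ b = y ∧ φ '' Set.Icc a b = S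

/-- A `Λ`-metric space is a `Λ`-tree if it is geodesic, if any two segments that meet in exactly
one point, which is an endpoint of both, have a segment as their union, and if the intersection
of any two segments with a common endpoint is a segment. -/
structure IsTree (d : LambdaMetric Λ X) : Prop where
  geodesic : ∀ x y : X, ∃ S : Set X, d.IsSegment S x y
  union_isSegment : ∀ (S T : Set X) (x y z : X), d.IsSegment S x y → d.IsSegment T y z →
    S ∩ T = {y} → ∃ u v : X, d.IsSegment (S ∪ T) u v
  inter_isSegment : ∀ (S T : Set X) (x y z : X), d.IsSegment S x y → d.IsSegment T x z →
    ∃ u v : X, d.IsSegment (S ∩ T) u v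

/-- A subset is a subtree if it contains every segment joining two of its points. -/
def IsSubtree (d : LambdaMetric Λ X) (A : Set X) : Prop :=
  ∀ x ∈ A, ∀ y ∈ A, ∀ S : Set X, d.IsSegment S x y → S ⊆ A

/-- The subtree spanned by `B`: the smallest subtree containing `B`. -/
def spannedSubtree (d : LambdaMetric Λ X) (B : Set X) : Set X :=
  ⋂₀ {A : Set X | d.IsSubtree A ∧ B ⊆ A}

/-- The action of `G` on `X` is `α`-affine: `d(gx, gy) = α_g d(x, y)`. -/
def IsAffineAction {G : Type*} [Group G] [MulAction G X] (d : LambdaMetric Λ X)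
    (α : G →* OrderAddAut Λ) : Prop :=
  ∀ (g : G) (x y : X), d.dist (g • x) (g • y) = twist α g (d.dist x y)

/-- The based length function `L_x(g) = d(x, gx)`. -/
def basedLength (G : Type*) [Group G] [MulAction G X] (d : LambdaMetric Λ X) (x : X) (g : G) :
    Λ :=
  d.dist x (g • x)

/-- `μ` is a `G`-equivariant isometry (not necessarily onto). -/
structure IsEquivariantIsometry (G : Type*) {Y : Type*} [Group G] [MulAction G X] [MulAction G Y]
    (d : LambdaMetric Λ X) (e : LambdaMetric Λ Y) (μ : X → Y) : Prop where
  dist_map : ∀ p q : X, e.dist (μ p) (μ q) = d.dist p q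
  map_smul : ∀ (g : G) (p : X), μ (g • p) = g • μ p

end Trees

end LambdaMetric

/-- The twisted Gromov product `c(g, h) = ½ (L(g) + L(h) - α_g L(g⁻¹h))`, an element of the
divisible hull of `Λ` (`DivisibleHull.mk a n` is the fraction `a / n`). -/
def lyndonC {Λ G : Type*} [AddCommGroup Λ] [LinearOrder Λ] [Group G]
    (α : G →* OrderAddAut Λ) (L : G → Λ) (g h : G) : DivisibleHull Λ :=
  DivisibleHull.mk (L g + L h - twist α g (L (g⁻¹ * h))) 2

/-- `L` is an `α`-affine Lyndon length function on `G`; `L1`, ..., `L4` are its axioms. -/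
structure IsAffineLyndonLength {Λ G : Type*} [AddCommGroup Λ] [LinearOrder Λ]
    [IsOrderedAddMonoid Λ] [Group G] (α : G →* OrderAddAut Λ) (L : G → Λ) : Prop where
  L1 : ∀ g h : G, ∃ a : Λ, lyndonC α L g h = DivisibleHull.coe a
  L2 : L 1 = 0
  L3 : ∀ g : G, L g = twist α g (L g⁻¹)
  L4 : ∀ g h k : G, lyndonC α L g h < lyndonC α L g k → lyndonC α L g h = lyndonC α L h k

/-! A geodesic `Λ`-metric space is a `Λ`-tree exactly when it satisfies the four-point condition and
all its triangles have perimeter in `2Λ` (`IsTree.fourPoint`, `IsTree.evenPerimeter`,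
`FourPoint.isTree`); medians of triples link the two descriptions.

For a based action, `α_g L(g⁻¹h)` is the distance from `gx` to `hx`, so `c(g, h)` is a Gromov
product at `x`: (L1) is evenness of perimeters and (L4) the four-point condition, both at the base
point. Conversely `δ(g, h) = α_g L(g⁻¹h)` is a hyperbolic pseudometric on `G`, since twisting by
`α_a` moves the base point from `1` to `a`.

The tree consists of the functions `f : G → Λ` that behave like the distances to a point of a
segment `[a, b]`, `a, b ∈ G`, under the sup distance, which is attained at `a` or `b`. No gluing or
quotient is needed, and `G` acts by translation and twisting. In any other tree realising `L`, the
same distances to the orbit determine one point, which gives `μ`, its equivariance and its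
uniqueness. -/

namespace LambdaMetric

/-! ### Betweenness and coordinates on segments -/

variable {Λ X : Type*} [AddCommGroup Λ] [LinearOrder Λ]

/-- The point `p` lies between `x` and `y`. -/
def Between (d : LambdaMetric Λ X) (x p y : X) : Prop :=
  d.dist x p + d.dist p y = d.dist x y

/-- The four-point (`0`-hyperbolicity) condition. -/
def FourPoint (d : LambdaMetric Λ X) : Prop :=
  ∀ x y z v, d.dist x y + d.dist z v ≤
    max (d.dist x z + d.dist y v) (d.dist x v + d.dist y z)

/-- All triangles have perimeter in `2Λ`. -/
def EvenPerimeter (d : LambdaMetric Λ X) : Prop :=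
  ∀ x y z, ∃ m : Λ, d.dist x y + d.dist y z + d.dist x z = m + m

theorem dist_self (d : LambdaMetric Λ X) (x : X) : d.dist x x = 0 :=
  (d.dist_eq_zero x x).2 rfl

section

variable {d : LambdaMetric Λ X} {S T : Set X} {x y z p q r w : X}

theorem eq_of_dist_nonpos (h : d.dist x y ≤ 0) : x = y :=
  (d.dist_eq_zero x y).1 (le_antisymm h (d.dist_nonneg x y))

theorem Between.of_le (h : d.dist x p + d.dist p y ≤ d.dist x y) : d.Between x p y :=
  le_antisymm h (d.dist_triangle x p y)

theorem Between.symm (h : d.Between x p y) : d.Between y p x := by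
  have := d.dist_comm x p
  have := d.dist_comm p y
  have := d.dist_comm x y
  unfold Between at *
  grind

theorem Between.left (x y : X) : d.Between x x y := by
  simp [Between, dist_self]

theorem Between.right (x y : X) : d.Between x y y := by
  simp [Between, dist_self]

variable [IsOrderedAddMonoid Λ]

theorem Between.trans (h : d.Between x p y) (h' : d.Between x q p) : d.Between x q y := by
  refine Between.of_le ?_
  have := d.dist_triangle q p y
  unfold Between at *
  grind

theorem Between.trans_right (h : d.Between x p y) (h' : d.Between x q p) : d.Between q p y := by
  refine Between.of_le ?_
  have := d.dist_triangle x q y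
  unfold Between at *
  grind

/-- A segment, reparametrised by the distance to its first endpoint. -/
theorem IsSegment.param (h : d.IsSegment S x y) : ∃ φ : Λ → X,
    (∀ s ∈ Set.Icc 0 (d.dist x y), ∀ t ∈ Set.Icc 0 (d.dist x y), d.dist (φ s) (φ t) = |s - t|) ∧
    φ 0 = x ∧ φ (d.dist x y) = y ∧ φ '' Set.Icc 0 (d.dist x y) = S := by
  obtain ⟨a, b, φ, hab, hφ, rfl, rfl, rfl⟩ := h
  have hd : d.dist (φ a) (φ b) = b - a := by
    rw [hφ a ⟨le_rfl, hab⟩ b ⟨hab, le_rfl⟩, abs_sub_comm, abs_of_nonneg (sub_nonneg.2 hab)]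
  rw [hd]
  refine ⟨fun t => φ (a + t), ?_, by simp, by simp, ?_⟩
  · intro s hs t ht
    rw [hφ _ (by grind) _ (by grind), add_sub_add_left_eq_sub]
  · rw [← Set.image_image φ (fun t => a + t)]
    simp

/-- `c` is the coordinate on the segment `S` that measures the distance to the endpoint `x`. -/
structure IsCoord (d : LambdaMetric Λ X) (S : Set X) (x y : X) (c : X → Λ) : Prop where
  dist_eq : ∀ p ∈ S, ∀ q ∈ S, d.dist p q = |c p - c q|
  exists_eq : ∀ t, 0 ≤ t → t ≤ d.dist x y → ∃ p ∈ S, c p = t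
  nonneg : ∀ p ∈ S, 0 ≤ c p
  le : ∀ p ∈ S, c p ≤ d.dist x y
  left : c x = 0
  right : c y = d.dist x y
  left_mem : x ∈ S
  right_mem : y ∈ S

theorem IsSegment.exists_coord (h : d.IsSegment S x y) : ∃ c, d.IsCoord S x y c := by
  obtain ⟨φ, hφ, h0, h1, rfl⟩ := h.param
  have hD := d.dist_nonneg x y
  have key : ∀ t ∈ Set.Icc 0 (d.dist x y), d.dist x (φ t) = t := by
    intro t ht
    have := hφ 0 ⟨le_rfl, hD⟩ t ht
    rw [h0, zero_sub, abs_neg, abs_of_nonneg ht.1] at this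
    exact this
  refine ⟨d.dist x, ?_, ?_, ?_, ?_, d.dist_self x, rfl, ⟨0, ⟨le_rfl, hD⟩, h0⟩,
    ⟨_, ⟨hD, le_rfl⟩, h1⟩⟩
  · rintro _ ⟨s, hs, rfl⟩ _ ⟨t, ht, rfl⟩
    rw [key s hs, key t ht, hφ s hs t ht]
  · intro t h0 h1
    exact ⟨φ t, ⟨t, ⟨h0, h1⟩, rfl⟩, key t ⟨h0, h1⟩⟩
  · rintro _ ⟨s, hs, rfl⟩
    rw [key s hs]
    exact hs.1
  · rintro _ ⟨s, hs, rfl⟩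
    rw [key s hs]
    exact hs.2

theorem IsCoord.isSegment {c : X → Λ} (h : d.IsCoord S x y c) : d.IsSegment S x y := by
  have hD := d.dist_nonneg x y
  have inj : ∀ p ∈ S, ∀ q ∈ S, c p = c q → p = q := by
    intro p hp q hq hpq
    refine (d.dist_eq_zero p q).1 ?_
    rw [h.dist_eq p hp q hq, hpq, sub_self, abs_zero]
  have ex : ∀ t : Λ, ∃ p, t ∈ Set.Icc 0 (d.dist x y) → p ∈ S ∧ c p = t := by
    intro t
    by_cases ht : t ∈ Set.Icc 0 (d.dist x y)
    · obtain ⟨p, hp⟩ := h.exists_eq t ht.1 ht.2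
      exact ⟨p, fun _ => hp⟩
    -- Outside the interval the value is arbitrary.
    · exact ⟨x, fun h => absurd h ht⟩
  choose φ hφ using ex
  refine ⟨0, d.dist x y, φ, hD, ?_, ?_, ?_, ?_⟩
  · intro s hs t ht
    rw [h.dist_eq _ (hφ s hs).1 _ (hφ t ht).1, (hφ s hs).2, (hφ t ht).2]
  · have := hφ 0 ⟨le_rfl, hD⟩
    exact inj _ this.1 _ h.left_mem (this.2.trans h.left.symm)
  · have := hφ _ ⟨hD, le_rfl⟩
    exact inj _ this.1 _ h.right_mem (this.2.trans h.right.symm)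
  · ext p
    constructor
    · rintro ⟨t, ht, rfl⟩
      exact (hφ t ht).1
    · intro hp
      have ht : c p ∈ Set.Icc 0 (d.dist x y) := ⟨h.nonneg p hp, h.le p hp⟩
      exact ⟨c p, ht, inj _ (hφ _ ht).1 _ hp (hφ _ ht).2⟩

theorem IsSegment.left_mem (h : d.IsSegment S x y) : x ∈ S :=
  let ⟨_, hc⟩ := h.exists_coord
  hc.left_mem

theorem IsSegment.right_mem (h : d.IsSegment S x y) : y ∈ S :=
  let ⟨_, hc⟩ := h.exists_coord
  hc.right_mem

theorem IsSegment.between (h : d.IsSegment S x y) (hp : p ∈ S) : d.Between x p y := by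
  obtain ⟨c, hc⟩ := h.exists_coord
  have h1 := hc.dist_eq x hc.left_mem p hp
  have h2 := hc.dist_eq p hp y hc.right_mem
  have := hc.left
  have := hc.right
  have h3 := hc.nonneg p hp
  have h4 := hc.le p hp
  rw [abs_of_nonpos (by grind)] at h1 h2
  unfold Between
  grind

/-- Among three points of a segment one lies between the other two. -/
theorem IsSegment.between_cases (h : d.IsSegment S x y) (hp : p ∈ S) (hq : q ∈ S) (hr : r ∈ S) :
    d.Between p q r ∨ d.Between q p r ∨ d.Between p r q := by
  obtain ⟨c, hc⟩ := h.exists_coord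
  unfold Between
  have hpq := hc.dist_eq p hp q hq
  have hqp := hc.dist_eq q hq p hp
  have hpr := hc.dist_eq p hp r hr
  have hqr := hc.dist_eq q hq r hr
  have hrq := hc.dist_eq r hr q hq
  grind [abs]

theorem IsSegment.between_left_cases (h : d.IsSegment S x y) (hp : p ∈ S) (hq : q ∈ S) :
    d.Between x p q ∨ d.Between x q p := by
  obtain ⟨c, hc⟩ := h.exists_coord
  unfold Between
  have := hc.left
  have := hc.nonneg p hp
  have := hc.nonneg q hq
  have hpq := hc.dist_eq p hp q hq
  have hqp := hc.dist_eq q hq p hp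
  have hpr := hc.dist_eq x hc.left_mem p hp
  have hqr := hc.dist_eq x hc.left_mem q hq
  grind [abs]

theorem IsSegment.exists_dist_eq (h : d.IsSegment S x y) (hp : p ∈ S) (hq : q ∈ S) {t : Λ}
    (h0 : 0 ≤ t) (h1 : t ≤ d.dist p q) : ∃ r ∈ S, d.Between p r q ∧ d.dist p r = t := by
  obtain ⟨c, hc⟩ := h.exists_coord
  have hpq := hc.dist_eq p hp q hq
  have hp0 := hc.nonneg p hp
  have hp1 := hc.le p hp
  have hq0 := hc.nonneg q hq
  have hq1 := hc.le q hq
  rcases le_total (c p) (c q) with hle | hle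
  · rw [abs_of_nonpos (by grind)] at hpq
    obtain ⟨r, hr, hcr⟩ := hc.exists_eq (c p + t) (by grind) (by grind)
    have e1 := hc.dist_eq p hp r hr
    have e2 := hc.dist_eq r hr q hq
    rw [abs_of_nonpos (by grind)] at e1 e2
    refine ⟨r, hr, ?_, ?_⟩ <;> (try unfold Between) <;> grind
  · rw [abs_of_nonneg (by grind)] at hpq
    obtain ⟨r, hr, hcr⟩ := hc.exists_eq (c p - t) (by grind) (by grind)
    have e1 := hc.dist_eq p hp r hr
    have e2 := hc.dist_eq r hr q hq
    rw [abs_of_nonneg (by grind)] at e1 e2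
    refine ⟨r, hr, ?_, ?_⟩ <;> (try unfold Between) <;> grind

theorem IsSegment.eq_of_dist_eq (h : d.IsSegment S x y) (hp : p ∈ S) (hq : q ∈ S)
    (hpq : d.dist x p = d.dist x q) : p = q := by
  obtain ⟨c, hc⟩ := h.exists_coord
  have key : ∀ p ∈ S, d.dist x p = c p := by
    intro p hp
    rw [hc.dist_eq x hc.left_mem p hp, hc.left, zero_sub, abs_neg, abs_of_nonneg (hc.nonneg p hp)]
  refine (d.dist_eq_zero p q).1 ?_
  rw [hc.dist_eq p hp q hq, ← key p hp, ← key q hq, hpq, sub_self, abs_zero]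

/-- `T` has a point at each distance from `x` up to `d(x, y)`, and a point of `S` is determined by
its distance to `x`. -/
theorem IsSegment.subset_of_subset (h : d.IsSegment S x y) {u v : X} (hT : d.IsSegment T u v)
    (hTS : T ⊆ S) (hx : x ∈ T) (hy : y ∈ T) : S ⊆ T := by
  intro p hp
  have hb := h.between hp
  obtain ⟨r, hr, -, hrt⟩ := hT.exists_dist_eq hx hy (d.dist_nonneg x p)
    (by have := d.dist_nonneg p y; unfold Between at hb; grind)
  rwa [h.eq_of_dist_eq hp (hTS hr) hrt.symm]

theorem IsSegment.sub (h : d.IsSegment S x y) (hp : p ∈ S) (hq : q ∈ S) :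
    d.IsSegment {r ∈ S | d.Between p r q} p q := by
  refine IsCoord.isSegment (c := d.dist p) ⟨?_, ?_, ?_, ?_, d.dist_self p, rfl,
    ⟨hp, Between.left p q⟩, ⟨hq, Between.right p q⟩⟩
  · rintro r ⟨hr, hr'⟩ s ⟨hs, hs'⟩
    obtain ⟨c, hc⟩ := h.exists_coord
    have := hc.dist_eq p hp q hq
    have := hc.dist_eq p hp r hr
    have := hc.dist_eq p hp s hs
    have := hc.dist_eq r hr s hs
    have := hc.dist_eq r hr q hq
    have := hc.dist_eq s hs q hq
    unfold Between at *
    grind [abs]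
  · intro t h0 h1
    obtain ⟨r, hr, hb, ht⟩ := h.exists_dist_eq hp hq h0 h1
    exact ⟨r, ⟨hr, hb⟩, ht⟩
  · exact fun r _ => d.dist_nonneg p r
  · rintro r ⟨-, hr⟩
    have := d.dist_nonneg r q
    unfold Between at hr
    grind

/-! ### From trees to hyperbolicity -/

theorem IsTree.segment_unique (hd : d.IsTree) (hS : d.IsSegment S x y) (hT : d.IsSegment T x y) :
    S = T := by
  obtain ⟨u, v, h⟩ := hd.inter_isSegment S T x y y hS hT
  have hx : x ∈ S ∩ T := ⟨hS.left_mem, hT.left_mem⟩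
  have hy : y ∈ S ∩ T := ⟨hS.right_mem, hT.right_mem⟩
  refine Set.Subset.antisymm (fun p hp => ?_) (fun p hp => ?_)
  · exact (hS.subset_of_subset h Set.inter_subset_left hx hy hp).2
  · exact (hT.subset_of_subset h Set.inter_subset_right hx hy hp).1

theorem IsTree.mem_of_between (hd : d.IsTree) (hS : d.IsSegment S x y) (hp : d.Between x p y) :
    p ∈ S := by
  obtain ⟨A, hA⟩ := hd.geodesic x p
  obtain ⟨B, hB⟩ := hd.geodesic p y
  have hAB : A ∩ B = {p} := by
    refine Set.Subset.antisymm ?_ (by rintro _ rfl; exact ⟨hA.right_mem, hB.left_mem⟩)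
    rintro q ⟨hqA, hqB⟩
    have h1 := hA.between hqA
    have h2 := hB.between hqB
    have := d.dist_triangle x q y
    have := d.dist_comm p q
    refine eq_of_dist_nonpos (d := d) ?_
    unfold Between at *
    grind
  -- The axiom does not say that the endpoints `u`, `v` are `x`, `y`, so the union is cut down to
  -- its part between `x` and `y`.
  obtain ⟨u, v, hR⟩ := hd.union_isSegment A B x p y hA hB hAB
  have hxR : x ∈ A ∪ B := Or.inl hA.left_mem
  have hyR : y ∈ A ∪ B := Or.inr hB.right_mem
  have hsub := hR.sub hxR hyR
  have hpR : p ∈ {r ∈ A ∪ B | d.Between x r y} := ⟨Or.inl hA.right_mem, hp⟩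
  rwa [hd.segment_unique hS hsub]

theorem IsTree.isSegment_between (hd : d.IsTree) (x y : X) :
    d.IsSegment {p | d.Between x p y} x y := by
  obtain ⟨S, hS⟩ := hd.geodesic x y
  convert hS using 1
  exact Set.Subset.antisymm (fun p hp => hd.mem_of_between hS hp) (fun p hp => hS.between hp)

theorem IsTree.between_of_inter_eq (hd : d.IsTree)
    (h : ∀ p, d.Between x p y → d.Between y p z → p = y) : d.Between x y z := by
  have hS := hd.isSegment_between x y
  have hT := hd.isSegment_between y z
  obtain ⟨u, v, hR⟩ := hd.union_isSegment _ _ x y z hS hT (by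
    refine Set.Subset.antisymm (fun p hp => h p hp.1 hp.2) ?_
    rintro _ rfl
    exact ⟨hS.right_mem, hT.left_mem⟩)
  rcases hR.between_cases (Or.inl hS.left_mem) (Or.inl hS.right_mem) (Or.inr hT.right_mem)
    with hb | hb | hb
  · exact hb
  · rw [h x (Between.left x y) hb]
    exact Between.left y z
  · rw [← h z hb (Between.right y z)]
    exact Between.right x z

theorem IsTree.exists_branch (hd : d.IsTree) (x y z : X) :
    ∃ w, d.Between x w y ∧ d.Between x w z ∧
      ∀ p, d.Between x p y → d.Between x p z → d.Between x p w := by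
  have hS := hd.isSegment_between x y
  have hT := hd.isSegment_between x z
  obtain ⟨u, v, hR⟩ := hd.inter_isSegment _ _ x y z hS hT
  have hu := hR.left_mem
  have hv := hR.right_mem
  -- Two points of `[x, y]` are ordered by their distance to `x`, so `x` separates them only if it
  -- is one of them. Hence one end of the intersection is `x`, and the other is the branch point.
  have key : ∀ a b, d.Between x a y → d.Between x b y → d.Between a x b → a = x ∨ b = x := by
    intro a b ha hb hab
    have := hS.between_left_cases ha hb
    have e1 := d.dist_comm x a
    have e2 := d.dist_comm b a
    have e3 := d.dist_comm x b
    have := d.dist_nonneg a b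
    have := d.dist_nonneg x a
    have := d.dist_nonneg x b
    have h1 : d.dist a x ≤ 0 → a = x := eq_of_dist_nonpos
    have h2 : d.dist b x ≤ 0 → b = x := eq_of_dist_nonpos
    unfold Between at *
    grind
  have hx : d.Between u x v := hR.between ⟨Between.left x y, Between.left x z⟩
  rcases key u v hu.1 hv.1 hx with rfl | rfl
  · exact ⟨v, hv.1, hv.2, fun p h1 h2 => hR.between ⟨h1, h2⟩⟩
  · exact ⟨u, hu.1, hu.2, fun p h1 h2 => (hR.between ⟨h1, h2⟩).symm⟩

/-- Take the branch point `w` seen from `x`. A common point of `[y, w]` and `[w, z]` lies on `[x,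
y]` and `[x, z]`, hence on `[x, w]`, so it is `w`; the two segments therefore concatenate. -/
theorem IsTree.exists_median (hd : d.IsTree) (x y z : X) :
    ∃ w, d.Between x w y ∧ d.Between x w z ∧ d.Between y w z := by
  obtain ⟨w, hy, hz, h⟩ := hd.exists_branch x y z
  refine ⟨w, hy, hz, hd.between_of_inter_eq fun p h1 h2 => ?_⟩
  have h3 := h p (hy.symm.trans h1).symm (hz.symm.trans h2.symm).symm
  have h4 := h1.symm
  have := d.dist_triangle x p y
  have := d.dist_comm p w
  refine eq_of_dist_nonpos (d := d) ?_
  unfold Between at *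
  grind

theorem IsTree.evenPerimeter (hd : d.IsTree) : d.EvenPerimeter := by
  intro x y z
  obtain ⟨w, h1, h2, h3⟩ := hd.exists_median x y z
  refine ⟨d.dist x w + d.dist y w + d.dist w z, ?_⟩
  have := d.dist_comm y w
  unfold Between at *
  grind

/-- The projections `a`, `b` of `x`, `y` to `[v, z]` are ordered along it. Routing `d(x, y)` through
the one nearer to `v` bounds the left side by one of the two sums. -/
theorem IsTree.fourPoint (hd : d.IsTree) : d.FourPoint := by
  intro x y z v
  obtain ⟨a, ha, ha', ha''⟩ := hd.exists_median v z x
  obtain ⟨b, hb, hb', hb''⟩ := hd.exists_median v z y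
  have key := (hd.isSegment_between v z).between_left_cases ha hb
  have := d.dist_comm x v
  have := d.dist_comm y v
  have := d.dist_comm z v
  have := d.dist_comm x y
  have := d.dist_comm x z
  have := d.dist_comm y z
  have := d.dist_triangle x a y
  have := d.dist_triangle x b y
  have := d.dist_comm x a
  have := d.dist_comm b y
  rcases key with h | h
  · have := hb'.trans h
    refine le_max_of_le_left ?_
    have := d.dist_comm z a
    unfold Between at *
    grind
  · have := ha'.trans h
    refine le_max_of_le_right ?_
    have := d.dist_comm z b
    have := d.dist_comm x b
    unfold Between at *
    grind

/-! ### From hyperbolicity to trees -/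

/-- Both sums on the right of the four-point inequality for `p, q, x, y` equal `d(x, y)`, which
forces `d(p, q) ≤ 0`. -/
theorem FourPoint.eq_of_between (hd : d.FourPoint) (hp : d.Between x p y) (hq : d.Between x q y)
    (hpq : d.dist x p = d.dist x q) : p = q := by
  have := hd p q x y
  have := d.dist_comm p x
  have := d.dist_comm q x
  refine eq_of_dist_nonpos (d := d) ?_
  unfold Between at *
  grind

theorem FourPoint.between_of_le (hd : d.FourPoint) (hp : d.Between x p y) (hq : d.Between x q y)
    (hpq : d.dist x p ≤ d.dist x q) : d.Between x p q := by
  have := hd p q x y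
  have := d.dist_comm p x
  have := d.dist_comm q x
  refine Between.of_le ?_
  unfold Between at *
  grind

theorem FourPoint.eq_between (hd : d.FourPoint) (hS : d.IsSegment S x y) :
    S = {p | d.Between x p y} := by
  refine Set.Subset.antisymm (fun p hp => hS.between hp) fun p hp => ?_
  have hp' : d.dist x p + d.dist p y = d.dist x y := hp
  obtain ⟨r, hr, hb, ht⟩ := hS.exists_dist_eq hS.left_mem hS.right_mem (d.dist_nonneg x p)
    (by have := d.dist_nonneg p y; grind)
  rwa [hd.eq_of_between hp hb ht.symm]

theorem FourPoint.exists_median (hd : d.FourPoint) (he : d.EvenPerimeter)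
    (hg : ∀ x y, ∃ S, d.IsSegment S x y) (x y z : X) :
    ∃ w, d.Between x w y ∧ d.Between x w z ∧ d.Between y w z := by
  obtain ⟨S, hS⟩ := hg x y
  obtain ⟨m, hm⟩ := he x y z
  have h1 := d.dist_triangle y x z
  have h2 := d.dist_triangle x z y
  have h3 := d.dist_comm x y
  have h4 := d.dist_comm y z
  have h5 := d.dist_triangle x y z
  -- `m - d(y, z)` is the Gromov product of `y` and `z` at `x`, in `Λ` by evenness.
  obtain ⟨w, hw, hb, ht⟩ := hS.exists_dist_eq (t := m - d.dist y z) hS.left_mem hS.right_mem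
    (by grind) (by grind)
  have h6 := hd w z x y
  have := d.dist_comm z x
  have := d.dist_comm w x
  have := d.dist_comm w y
  refine ⟨w, hb, Between.of_le ?_, Between.of_le ?_⟩ <;> unfold Between at * <;> grind

theorem FourPoint.isTree (hd : d.FourPoint) (he : d.EvenPerimeter)
    (hg : ∀ x y, ∃ S, d.IsSegment S x y) : d.IsTree := by
  have hseg : ∀ x y, d.IsSegment {p | d.Between x p y} x y := by
    intro x y
    obtain ⟨S, hS⟩ := hg x y
    rwa [← hd.eq_between hS]
  refine ⟨hg, ?_, ?_⟩
  · intro S T x y z hS hT hST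
    rw [hd.eq_between hS, hd.eq_between hT] at hST ⊢
    obtain ⟨w, h1, h2, h3⟩ := hd.exists_median he hg x y z
    obtain rfl : w = y := by
      have : w ∈ ({y} : Set X) := hST ▸ ⟨h1, h3⟩
      exact this
    refine ⟨x, z, ?_⟩
    convert hseg x z using 1
    ext p
    constructor
    · rintro (hp | hp)
      · exact h2.trans hp
      · exact (h2.symm.trans hp.symm).symm
    · intro hp
      by_cases hle : d.dist x p ≤ d.dist x w
      · exact .inl (hd.between_of_le hp h2 hle)
      · exact .inr (hp.trans_right (hd.between_of_le h2 hp (le_of_not_ge hle)))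
  · intro S T x y z hS hT
    rw [hd.eq_between hS, hd.eq_between hT]
    obtain ⟨w, h1, h2, h3⟩ := hd.exists_median he hg x y z
    refine ⟨x, w, ?_⟩
    convert hseg x w using 1
    ext p
    constructor
    · rintro ⟨hp, hp'⟩
      refine hd.between_of_le hp h1 ?_
      have := d.dist_triangle y p z
      have := d.dist_comm y p
      have := d.dist_comm y w
      simp only [Set.mem_ofPred_eq, Between] at *
      grind
    · intro hp
      exact ⟨h1.trans hp, h2.trans hp⟩

end

end LambdaMetric

/-! ### The tree spanned by a hyperbolic pseudometric -/

/-- A `Λ`-valued pseudometric that satisfies the four-point condition and whose triangles have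
perimeter in `2Λ`. -/
structure IsHypPseudoMetric {Λ A : Type*} [AddCommGroup Λ] [LinearOrder Λ] (δ : A → A → Λ) :
    Prop where
  self : ∀ a, δ a a = 0
  comm : ∀ a b, δ a b = δ b a
  fourPoint : ∀ a b c e, δ a b + δ c e ≤ max (δ a c + δ b e) (δ a e + δ b c)
  even : ∀ a b c, ∃ m : Λ, δ a b + δ b c + δ a c = m + m

/-- `f` is the distance function to a point on a segment in the tree spanned by `(A, δ)`. -/
structure IsHullFun {Λ A : Type*} [AddCommGroup Λ] [LinearOrder Λ] (δ : A → A → Λ) (f : A → Λ) :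
    Prop where
  le_add : ∀ a b, δ a b ≤ f a + f b
  fourPoint : ∀ a b c, f c + δ a b ≤ max (f a + δ b c) (f b + δ a c)
  exists_add_eq : ∃ a b, f a + f b = δ a b

/-- The tree spanned by `(A, δ)`, with points represented by their distance functions. -/
def Hull {Λ A : Type*} [AddCommGroup Λ] [LinearOrder Λ] (δ : A → A → Λ) : Type _ :=
  {f : A → Λ // IsHullFun δ f}

section Hull

variable {Λ A : Type*} [AddCommGroup Λ] [LinearOrder Λ] {δ : A → A → Λ}

namespace IsHullFun

variable [IsOrderedAddMonoid Λ] {f g k l : A → Λ} {a b c : A}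

theorem nonneg (hδ : IsHypPseudoMetric δ) (hf : IsHullFun δ f) (a : A) : 0 ≤ f a := by
  have := hf.le_add a a
  have := hδ.self a
  grind

/-- Insert `δ b c ≤ f b + f c` and `δ a c ≤ f a + f c` into the four-point inequality of `g`;
`sub_le'` exchanges the roles. Together they say that `|f - g|` is bounded by its behaviour at `a`
and `b`. -/
theorem sub_le (hf : IsHullFun δ f) (hab : f a + f b = δ a b) (hg : IsHullFun δ g) (c : A) :
    g c - f c ≤ max (g a - f a) (g b - f b) := by
  have := hg.fourPoint a b c
  have := hf.fourPoint a b c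
  have := hf.fourPoint a c b
  have := hf.le_add a c
  have := hf.le_add b c
  grind

theorem sub_le' (hδ : IsHypPseudoMetric δ) (hf : IsHullFun δ f) (hab : f a + f b = δ a b)
    (hg : IsHullFun δ g) (c : A) : f c - g c ≤ max (g a - f a) (g b - f b) := by
  have := hf.fourPoint a b c
  have := hg.le_add a c
  have := hg.le_add b c
  have := hδ.comm a c
  have := hδ.comm b c
  grind

end IsHullFun

namespace Hull

variable [IsOrderedAddMonoid Λ]

/-- The distance between two points of the hull. -/
noncomputable def hdist (p q : Hull δ) : Λ :=
  max (q.1 p.2.exists_add_eq.choose - p.1 p.2.exists_add_eq.choose)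
    (q.1 p.2.exists_add_eq.choose_spec.choose - p.1 p.2.exists_add_eq.choose_spec.choose)

theorem sub_le_hdist (p q : Hull δ) (c : A) : q.1 c - p.1 c ≤ hdist p q :=
  p.2.sub_le p.2.exists_add_eq.choose_spec.choose_spec q.2 c

theorem sub_le_hdist' (hδ : IsHypPseudoMetric δ) (p q : Hull δ) (c : A) :
    p.1 c - q.1 c ≤ hdist p q :=
  p.2.sub_le' hδ p.2.exists_add_eq.choose_spec.choose_spec q.2 c

/-- The distance does not depend on the chosen pair. -/
theorem hdist_eq_max (p q : Hull δ) {a b : A} (hab : p.1 a + p.1 b = δ a b) :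
    hdist p q = max (q.1 a - p.1 a) (q.1 b - p.1 b) := by
  refine le_antisymm ?_ (max_le (sub_le_hdist p q a) (sub_le_hdist p q b))
  exact max_le (p.2.sub_le hab q.2 _) (p.2.sub_le hab q.2 _)

theorem exists_hdist_eq (hδ : IsHypPseudoMetric δ) (p q : Hull δ) :
    ∃ a b, p.1 a + p.1 b = δ a b ∧ hdist p q = q.1 a - p.1 a := by
  obtain ⟨a, b, h⟩ := p.2.exists_add_eq
  rcases max_choice (q.1 a - p.1 a) (q.1 b - p.1 b) with e | e
  · exact ⟨a, b, h, (hdist_eq_max p q h).trans e⟩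
  · exact ⟨b, a, by rw [add_comm, h, hδ.comm], (hdist_eq_max p q h).trans e⟩

theorem hdist_comm (hδ : IsHypPseudoMetric δ) (p q : Hull δ) : hdist p q = hdist q p := by
  refine le_antisymm ?_ ?_
  · obtain ⟨a, b, -, h⟩ := exists_hdist_eq hδ p q
    exact h.le.trans (sub_le_hdist' hδ q p a)
  · obtain ⟨a, b, -, h⟩ := exists_hdist_eq hδ q p
    exact h.le.trans (sub_le_hdist' hδ p q a)

theorem hdist_eq_zero (hδ : IsHypPseudoMetric δ) (p q : Hull δ) : hdist p q = 0 ↔ p = q := by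
  constructor
  · intro h
    refine Subtype.ext (funext fun c => ?_)
    have h1 := sub_le_hdist p q c
    have h2 := sub_le_hdist' hδ p q c
    grind
  · rintro rfl
    obtain ⟨a, b, -, h⟩ := exists_hdist_eq hδ p p
    rw [h, sub_self]

/-- The `Λ`-metric of the hull. -/
noncomputable def metric (hδ : IsHypPseudoMetric δ) : LambdaMetric Λ (Hull δ) where
  dist := hdist
  dist_nonneg p q := by
    obtain ⟨a, -⟩ := p.2.exists_add_eq
    have h1 := sub_le_hdist p q a
    have h2 := sub_le_hdist' hδ p q a
    grind
  dist_eq_zero := hdist_eq_zero hδ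
  dist_comm := hdist_comm hδ
  dist_triangle p q r := by
    obtain ⟨a, b, -, h⟩ := exists_hdist_eq hδ p r
    have h1 := sub_le_hdist p q a
    have h2 := sub_le_hdist q r a
    grind

/-- The distance function of a point of `A`. -/
def of (hδ : IsHypPseudoMetric δ) (a : A) : Hull δ := by
  refine ⟨δ a, ?_, ?_, a, a, ?_⟩
  · intro b c
    have := hδ.fourPoint b c a a
    have := hδ.self a
    have := hδ.comm a b
    have := hδ.comm a c
    grind
  · intro b c e
    have := hδ.fourPoint a e b c
    have := hδ.comm e b
    have := hδ.comm e c
    grind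
  · rw [hδ.self, add_zero]

theorem hdist_of (hδ : IsHypPseudoMetric δ) (a : A) (p : Hull δ) : hdist (of hδ a) p = p.1 a := by
  rw [hdist_eq_max (a := a) (b := a)]
  · simp [of, hδ.self]
  · simp [of, hδ.self]

/-- The segment from `q` to `p` may be continued to a point of `A`. -/
theorem exists_hdist_add (hδ : IsHypPseudoMetric δ) (p q : Hull δ) :
    ∃ a, hdist p q + p.1 a = q.1 a := by
  obtain ⟨a, b, -, h⟩ := exists_hdist_eq hδ p q
  exact ⟨a, by rw [h, sub_add_cancel]⟩

/-- The four-point condition passes from `A` to the hull by replacing points one at a time. With two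
hull points the inequality takes two forms, this one and `add_hdist_le`. -/
theorem fourPoint_one (hδ : IsHypPseudoMetric δ) (p q : Hull δ) (a b : A) :
    p.1 a + q.1 b ≤ max (δ a b + hdist p q) (q.1 a + p.1 b) := by
  obtain ⟨c, e, hce, h⟩ := exists_hdist_eq hδ p q
  have h1 := p.2.fourPoint c e a
  have h3 := q.2.fourPoint c a b
  have h4 := q.2.fourPoint e a b
  have h5 := p.2.le_add c b
  have h6 := p.2.le_add e b
  have h7 := sub_le_hdist p q c
  have h8 := sub_le_hdist p q e
  have := hδ.comm a c
  have := hδ.comm a e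
  have := hδ.comm a b
  clear h
  -- As `p` lies between `c` and `e`, its distance to `a` is measured from `e` or from `c`; that
  -- endpoint then replaces `p`.
  rcases le_max_iff.1 h1 with h1 | h1
  · rcases le_max_iff.1 h4 with h4 | h4
    · refine le_max_of_le_left ?_
      grind
    · refine le_max_of_le_right ?_
      grind
  · rcases le_max_iff.1 h3 with h3 | h3
    · refine le_max_of_le_left ?_
      grind
    · refine le_max_of_le_right ?_
      grind

theorem add_hdist_le (hδ : IsHypPseudoMetric δ) (p q : Hull δ) (a b : A) :
    δ a b + hdist p q ≤ max (p.1 a + q.1 b) (p.1 b + q.1 a) := by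
  obtain ⟨c, hc⟩ := exists_hdist_add hδ p q
  have := q.2.fourPoint a b c
  have := p.2.le_add a c
  have := p.2.le_add b c
  grind

theorem fourPoint_two (hδ : IsHypPseudoMetric δ) (p q r : Hull δ) (a : A) :
    p.1 a + hdist q r ≤ max (q.1 a + hdist p r) (r.1 a + hdist p q) := by
  obtain ⟨b, hb⟩ := exists_hdist_add hδ q r
  have h1 := fourPoint_one hδ p r a b
  have h2 := q.2.le_add a b
  have h3 := sub_le_hdist' hδ p q b
  grind

theorem fourPoint (hδ : IsHypPseudoMetric δ) : (metric hδ).FourPoint := by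
  intro p q r s
  change hdist p q + hdist r s ≤ max (hdist p r + hdist q s) (hdist p s + hdist q r)
  obtain ⟨a, ha⟩ := exists_hdist_add hδ p q
  have h1 := fourPoint_two hδ q r s a
  have h2 := sub_le_hdist p r a
  have h3 := sub_le_hdist p s a
  grind

theorem exists_sub_eq (hδ : IsHypPseudoMetric δ) (p : Hull δ) (a b : A) :
    ∃ m : Λ, p.1 a + p.1 b + δ a b = m + m := by
  obtain ⟨c, e, h⟩ := p.2.exists_add_eq
  -- A path to `x` from `c` or from `e` passes through `p`, and `p.1 e = δ c e - p.1 c`. Parity thus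
  -- reduces to triangles in `A`.
  have key : ∀ x, p.1 x = δ c x - p.1 c ∨ p.1 x = δ e x - δ c e + p.1 c := by
    intro x
    have := p.2.fourPoint c e x
    have := p.2.le_add c x
    have := p.2.le_add e x
    grind
  obtain ⟨m₁, h₁⟩ := hδ.even c a b
  obtain ⟨m₂, h₂⟩ := hδ.even e a b
  obtain ⟨m₃, h₃⟩ := hδ.even c e b
  obtain ⟨m₄, h₄⟩ := hδ.even c e a
  rcases key a with h5 | h5 <;> rcases key b with h6 | h6
  · exact ⟨m₁ - p.1 c, by grind⟩
  · exact ⟨m₁ + m₃ - δ c b - δ c e, by grind⟩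
  · exact ⟨m₁ + m₄ - δ c a - δ c e, by grind⟩
  · exact ⟨m₂ - δ c e + p.1 c, by grind⟩

theorem exists_hdist_add_eq (hδ : IsHypPseudoMetric δ) (p q : Hull δ) (a : A) :
    ∃ m : Λ, hdist p q + p.1 a + q.1 a = m + m := by
  obtain ⟨b, hb⟩ := exists_hdist_add hδ p q
  obtain ⟨m₁, h₁⟩ := exists_sub_eq hδ p a b
  obtain ⟨m₂, h₂⟩ := exists_sub_eq hδ q a b
  exact ⟨m₁ + m₂ - p.1 b - δ a b, by grind⟩

theorem evenPerimeter (hδ : IsHypPseudoMetric δ) : (metric hδ).EvenPerimeter := by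
  intro p q r
  change ∃ m, hdist p q + hdist q r + hdist p r = m + m
  obtain ⟨a, -⟩ := p.2.exists_add_eq
  obtain ⟨m₁, h₁⟩ := exists_hdist_add_eq hδ p q a
  obtain ⟨m₂, h₂⟩ := exists_hdist_add_eq hδ q r a
  obtain ⟨m₃, h₃⟩ := exists_hdist_add_eq hδ p r a
  exact ⟨m₁ + m₂ + m₃ - p.1 a - q.1 a - r.1 a, by grind⟩

/-- The segment from `q` to `p` extends beyond `p` to `a`; as `q` lies between `c` and `e`, the
segment from `a` to `q` extends to one of them. -/
theorem exists_between (hδ : IsHypPseudoMetric δ) (p q : Hull δ) :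
    ∃ a b, δ a b = p.1 a + hdist p q + q.1 b := by
  obtain ⟨a, ha⟩ := exists_hdist_add hδ p q
  obtain ⟨c, e, hce⟩ := q.2.exists_add_eq
  have h := q.2.fourPoint c e a
  have := q.2.le_add c a
  have := q.2.le_add e a
  have := hδ.comm c a
  have := hδ.comm e a
  rcases le_max_iff.1 h with h | h
  · exact ⟨a, e, by grind⟩
  · exact ⟨a, c, by grind⟩

/-- The point at distance `t` from `p` on the segment from `p` to `q`. -/
noncomputable def point (hδ : IsHypPseudoMetric δ) (p q : Hull δ) (t : Λ) (h0 : 0 ≤ t) (h1 : t ≤ hdist p q) :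
    Hull δ := by
  -- The triangle inequality gives two lower bounds for the distance to `c`, through `p` and through
  -- `q`; in a tree the larger one is attained.
  refine ⟨fun c => max (p.1 c - t) (q.1 c - (hdist p q - t)), ?_, ?_, ?_⟩
  · intro a b
    have := add_hdist_le hδ p q a b
    grind
  · intro a b c
    have := p.2.fourPoint a b c
    have := q.2.fourPoint a b c
    grind
  · obtain ⟨a, b, h⟩ := exists_between hδ p q
    refine ⟨a, b, ?_⟩
    have := sub_le_hdist p q a
    have := sub_le_hdist' hδ p q b
    have := p.2.le_add a b
    have := q.2.le_add a b
    grind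

theorem point_spec (hδ : IsHypPseudoMetric δ) (p q : Hull δ) (t : Λ) (h0 : 0 ≤ t)
    (h1 : t ≤ hdist p q) : hdist p (point hδ p q t h0 h1) = t ∧
      hdist (point hδ p q t h0 h1) q = hdist p q - t := by
  have h2 : hdist p (point hδ p q t h0 h1) ≤ t := by
    obtain ⟨c, hc⟩ := exists_hdist_add hδ p (point hδ p q t h0 h1)
    have := sub_le_hdist p q c
    have hp : (point hδ p q t h0 h1).1 c = max (p.1 c - t) (q.1 c - (hdist p q - t)) := rfl
    grind
  have h3 : hdist (point hδ p q t h0 h1) q ≤ hdist p q - t := by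
    obtain ⟨c, hc⟩ := exists_hdist_add hδ (point hδ p q t h0 h1) q
    have hp : (point hδ p q t h0 h1).1 c = max (p.1 c - t) (q.1 c - (hdist p q - t)) := rfl
    grind
  have h4 : hdist p q ≤ _ + _ := (metric hδ).dist_triangle p (point hδ p q t h0 h1) q
  change _ ≤ hdist p (point hδ p q t h0 h1) + hdist (point hδ p q t h0 h1) q at h4
  grind

end Hull

end Hull

/-- In a four-point space, it suffices for geodesicity to find points at prescribed distances. -/
theorem LambdaMetric.FourPoint.isSegment_between {Λ X : Type*} [AddCommGroup Λ] [LinearOrder Λ]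
    [IsOrderedAddMonoid Λ] {d : LambdaMetric Λ X} (hd : d.FourPoint) {x y : X}
    (h : ∀ t, 0 ≤ t → t ≤ d.dist x y → ∃ p, d.Between x p y ∧ d.dist x p = t) :
    d.IsSegment {p | d.Between x p y} x y := by
  refine IsCoord.isSegment (c := d.dist x) ⟨?_, ?_, ?_, ?_, d.dist_self x, rfl,
    Between.left x y, Between.right x y⟩
  · intro p hp q hq
    rcases le_total (d.dist x p) (d.dist x q) with hle | hle
    · have := hd.between_of_le hp hq hle
      unfold Between at this
      grind [abs]
    · have := hd.between_of_le hq hp hle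
      have := d.dist_comm p q
      unfold Between at *
      grind [abs]
  · exact fun t h0 h1 => h t h0 h1
  · exact fun p _ => d.dist_nonneg x p
  · intro p hp
    have := d.dist_nonneg p y
    simp only [Between, Set.mem_ofPred_eq] at hp
    grind

theorem Hull.isTree {Λ A : Type*} [AddCommGroup Λ] [LinearOrder Λ] [IsOrderedAddMonoid Λ]
    {δ : A → A → Λ} (hδ : IsHypPseudoMetric δ) : (Hull.metric hδ).IsTree := by
  refine (fourPoint hδ).isTree (evenPerimeter hδ) fun p q => ⟨_,
    (fourPoint hδ).isSegment_between fun t h0 h1 => ?_⟩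
  have := point_spec hδ p q t h0 h1
  exact ⟨point hδ p q t h0 h1,
    (congrArg₂ (· + ·) this.1 this.2).trans (add_sub_cancel t (hdist p q)), this.1⟩

/-! ### Twisting by `α`, and the axioms with denominators cleared -/

section Twist

variable {Λ G : Type*} [AddCommGroup Λ] [LinearOrder Λ] [Group G] (α : G →* OrderAddAut Λ)

theorem twist_add (g : G) (a b : Λ) : twist α g (a + b) = twist α g a + twist α g b :=
  (α g).2 a b

theorem twist_one (a : Λ) : twist α 1 a = a := by
  simp [twist]

theorem twist_mul (g h : G) (a : Λ) : twist α (g * h) a = twist α g (twist α h a) := by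
  simp [twist]

theorem twist_le_iff (g : G) (a b : Λ) : twist α g a ≤ twist α g b ↔ a ≤ b :=
  (α g : Λ ≃o Λ).le_iff_le

theorem twist_max (g : G) (a b : Λ) : twist α g (max a b) = max (twist α g a) (twist α g b) :=
  (α g : Λ ≃o Λ).monotone.map_max

theorem twist_zero (g : G) : twist α g (0 : Λ) = 0 := by
  have := twist_add α g (0 : Λ) 0
  simpa using this

theorem twist_sub (g : G) (a b : Λ) : twist α g (a - b) = twist α g a - twist α g b := by
  rw [eq_sub_iff_add_eq, ← twist_add, sub_add_cancel]

variable [IsOrderedAddMonoid Λ] (L : G → Λ)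

theorem lyndonC_eq_coe_iff (g h : G) (a : Λ) : lyndonC α L g h = DivisibleHull.coe a ↔
    L g + L h - twist α g (L (g⁻¹ * h)) = a + a := by
  rw [lyndonC, DivisibleHull.coe, DivisibleHull.mk_eq_mk_iff_smul_eq_smul]
  simp [two_nsmul]

theorem lyndonC_eq_iff (g h g' h' : G) : lyndonC α L g h = lyndonC α L g' h' ↔
    L g + L h - twist α g (L (g⁻¹ * h)) = L g' + L h' - twist α g' (L (g'⁻¹ * h')) :=
  (DivisibleHull.mk_left_injective 2).eq_iff

theorem lyndonC_lt_iff (g h g' h' : G) : lyndonC α L g h < lyndonC α L g' h' ↔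
    L g + L h - twist α g (L (g⁻¹ * h)) < L g' + L h' - twist α g' (L (g'⁻¹ * h')) := by
  rw [lyndonC, lyndonC, DivisibleHull.mk_lt_mk]
  change 2 • _ < 2 • _ ↔ _
  simp only [two_nsmul]
  grind

end Twist

/-! ### Based length functions of affine actions -/

section BasedLength

variable {Λ G X : Type*} [AddCommGroup Λ] [LinearOrder Λ] [Group G]
  {α : G →* OrderAddAut Λ} [MulAction G X] {d : LambdaMetric Λ X}

theorem LambdaMetric.IsAffineAction.twist_basedLength (hα : d.IsAffineAction α) (x : X) (g h : G) :
    twist α g (d.basedLength G x (g⁻¹ * h)) = d.dist (g • x) (h • x) := by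
  rw [basedLength, ← hα, smul_smul, mul_inv_cancel_left]

theorem LambdaMetric.IsTree.isAffineLyndonLength [IsOrderedAddMonoid Λ] (hd : d.IsTree)
    (hα : d.IsAffineAction α) (x : X) : IsAffineLyndonLength α (d.basedLength G x) where
  L1 g h := by
    simp only [lyndonC_eq_coe_iff, hα.twist_basedLength]
    simp only [basedLength]
    obtain ⟨m, hm⟩ := hd.evenPerimeter x (g • x) (h • x)
    exact ⟨m - d.dist (g • x) (h • x), by grind⟩
  L2 := by rw [basedLength, one_smul, dist_self]
  L3 g := by
    rw [← mul_one g⁻¹, hα.twist_basedLength, one_smul, d.dist_comm, basedLength]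
  L4 g h k := by
    simp only [lyndonC_eq_iff, lyndonC_lt_iff, hα.twist_basedLength]
    simp only [basedLength]
    intro hlt
    -- Over all pairings, the four-point condition says that the two largest of the three sums
    -- agree, so the two smallest Gromov products agree.
    have := hd.fourPoint x (g • x) (h • x) (k • x)
    have := hd.fourPoint x (h • x) (g • x) (k • x)
    have := hd.fourPoint x (k • x) (h • x) (g • x)
    have := d.dist_comm (g • x) (h • x)
    have := d.dist_comm (g • x) (k • x)
    have := d.dist_comm (h • x) (k • x)
    grind

end BasedLength

/-! ### The tree of a Lyndon length function -/

section Lyndon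

variable {Λ G : Type*} [AddCommGroup Λ] [LinearOrder Λ] [Group G]

/-- The pseudometric on `G` defined by a length function: `δ(g, h) = α_g L(g⁻¹h)`. -/
def lengthDist (α : G →* OrderAddAut Λ) (L : G → Λ) (g h : G) : Λ :=
  twist α g (L (g⁻¹ * h))

theorem twist_lengthDist (α : G →* OrderAddAut Λ) (L : G → Λ) (k g h : G) :
    twist α k (lengthDist α L g h) = lengthDist α L (k * g) (k * h) := by
  rw [lengthDist, lengthDist, ← twist_mul, mul_inv_rev, mul_assoc, inv_mul_cancel_left]

theorem lengthDist_one (α : G →* OrderAddAut Λ) (L : G → Λ) (g : G) :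
    lengthDist α L 1 g = L g := by
  rw [lengthDist, twist_one, inv_one, one_mul]

theorem twist_lengthDist_inv (α : G →* OrderAddAut Λ) (L : G → Λ) (k g h : G) :
    lengthDist α L g h = twist α k (lengthDist α L (k⁻¹ * g) (k⁻¹ * h)) := by
  rw [twist_lengthDist, mul_inv_cancel_left, mul_inv_cancel_left]

theorem lengthDist_basedLength {Z : Type*} [MulAction G Z] {e : LambdaMetric Λ Z} {z : Z}
    {α : G →* OrderAddAut Λ} (hα : e.IsAffineAction α) (g h : G) :
    lengthDist α (e.basedLength G z) g h = e.dist (g • z) (h • z) :=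
  hα.twist_basedLength z g h

namespace Hull

/-- The action of `G` on the tree of a length function. -/
instance mulAction (α : G →* OrderAddAut Λ) (L : G → Λ) : MulAction G (Hull (lengthDist α L)) where
  smul k p := by
    refine ⟨fun g => twist α k (p.1 (k⁻¹ * g)), ?_, ?_, ?_⟩
    · intro a b
      rw [twist_lengthDist_inv α L k a b, ← twist_add, twist_le_iff]
      exact p.2.le_add _ _
    · intro a b c
      rw [twist_lengthDist_inv α L k a b, twist_lengthDist_inv α L k a c,
        twist_lengthDist_inv α L k b c, ← twist_add, ← twist_add, ← twist_add, ← twist_max,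
        twist_le_iff]
      exact p.2.fourPoint _ _ _
    · obtain ⟨a, b, h⟩ := p.2.exists_add_eq
      refine ⟨k * a, k * b, ?_⟩
      rw [← twist_add, inv_mul_cancel_left, inv_mul_cancel_left, h, twist_lengthDist]
  one_smul p := by
    refine Subtype.ext (funext fun g => ?_)
    change twist α 1 (p.1 (1⁻¹ * g)) = p.1 g
    rw [twist_one, inv_one, one_mul]
  mul_smul k l p := by
    refine Subtype.ext (funext fun g => ?_)
    change twist α (k * l) (p.1 ((k * l)⁻¹ * g)) = twist α k (twist α l (p.1 (l⁻¹ * (k⁻¹ * g))))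
    rw [twist_mul, mul_inv_rev, mul_assoc]

theorem smul_apply {α : G →* OrderAddAut Λ} {L : G → Λ} (k : G) (p : Hull (lengthDist α L)) (g : G) :
    (k • p).1 g = twist α k (p.1 (k⁻¹ * g)) := rfl

end Hull

variable [IsOrderedAddMonoid Λ] {α : G →* OrderAddAut Λ} {L : G → Λ}

theorem IsAffineLyndonLength.lengthDist_comm (hL : IsAffineLyndonLength α L) (g h : G) :
    lengthDist α L g h = lengthDist α L h g := by
  rw [lengthDist, hL.L3, ← twist_mul, mul_inv_cancel_left, mul_inv_rev, inv_inv, lengthDist]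

/-- Nonnegativity and the triangle inequality need no axiom: they are four-point inequalities with
repeated points. -/
theorem IsAffineLyndonLength.isHypPseudoMetric (hL : IsAffineLyndonLength α L) :
    IsHypPseudoMetric (lengthDist α L) where
  self g := by rw [lengthDist, inv_mul_cancel, hL.L2, twist_zero]
  comm := hL.lengthDist_comm
  fourPoint a b c e := by
    -- Base point `1`: either `c(c, e) ≥ c(c, b)`, or (L4) gives `c(c, e) = c(e, b)`; each case
    -- bounds the left side by one term of the maximum. Applying `α_a` then moves the base point to
    -- `a`.
    have key : ∀ b c e, L b + lengthDist α L c e ≤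
        max (L c + lengthDist α L b e) (L e + lengthDist α L b c) := by
      intro b c e
      have h := hL.L4 c e b
      simp only [lyndonC_eq_iff, lyndonC_lt_iff] at h
      change L c + L e - lengthDist α L c e < L c + L b - lengthDist α L c b →
        L c + L e - lengthDist α L c e = L e + L b - lengthDist α L e b at h
      have := hL.lengthDist_comm c b
      have := hL.lengthDist_comm e b
      grind
    have h := (twist_le_iff α a _ _).2 (key (a⁻¹ * b) (a⁻¹ * c) (a⁻¹ * e))
    simp only [← lengthDist_one α L, twist_add, twist_max, twist_lengthDist, mul_inv_cancel_left,
      mul_one] at h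
    exact h
  even a b c := by
    obtain ⟨m, hm⟩ := hL.L1 (a⁻¹ * b) (a⁻¹ * c)
    rw [lyndonC_eq_coe_iff] at hm
    change _ - lengthDist α L _ _ = _ at hm
    have h := congrArg (twist α a) hm
    simp only [← lengthDist_one α L, twist_add, twist_sub, twist_lengthDist, mul_inv_cancel_left,
      mul_one] at h
    exact ⟨twist α a m + lengthDist α L b c, by grind⟩

namespace Hull

theorem smul_of (hL : IsAffineLyndonLength α L) (k g : G) :
    k • of hL.isHypPseudoMetric g = of hL.isHypPseudoMetric (k * g) := by
  refine Subtype.ext (funext fun h => ?_)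
  rw [smul_apply]
  change twist α k (lengthDist α L g (k⁻¹ * h)) = lengthDist α L (k * g) h
  rw [twist_lengthDist, mul_inv_cancel_left]

theorem isAffineAction (hL : IsAffineLyndonLength α L) :
    (metric hL.isHypPseudoMetric).IsAffineAction α := by
  intro k p q
  change hdist (k • p) (k • q) = twist α k (hdist p q)
  obtain ⟨a, b, h⟩ := p.2.exists_add_eq
  rw [hdist_eq_max p q h, hdist_eq_max (k • p) (k • q) (a := k * a) (b := k * b), twist_max,
    twist_sub, twist_sub]
  · simp only [smul_apply, inv_mul_cancel_left]
  · simp only [smul_apply, inv_mul_cancel_left]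
    rw [← twist_add, h, twist_lengthDist]

/-- The base point of the tree of a length function. -/
def base (hL : IsAffineLyndonLength α L) : Hull (lengthDist α L) :=
  of hL.isHypPseudoMetric 1

theorem smul_base (hL : IsAffineLyndonLength α L) (g : G) :
    g • base hL = of hL.isHypPseudoMetric g := by
  rw [base, smul_of hL, mul_one]

theorem basedLength_base (hL : IsAffineLyndonLength α L) :
    (metric hL.isHypPseudoMetric).basedLength G (base hL) = L := by
  funext g
  change hdist (base hL) (g • base hL) = L g
  rw [base, hdist_of, smul_of hL, mul_one]
  change lengthDist α L g 1 = L g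
  rw [hL.isHypPseudoMetric.comm, lengthDist_one]

theorem dist_smul_base (hL : IsAffineLyndonLength α L) (p : Hull (lengthDist α L)) (g : G) :
    (metric hL.isHypPseudoMetric).dist p (g • base hL) = p.1 g := by
  rw [LambdaMetric.dist_comm, smul_base]
  exact hdist_of _ g p

theorem dist_smul_base_smul_base (hL : IsAffineLyndonLength α L) (g h : G) :
    (metric hL.isHypPseudoMetric).dist (g • base hL) (h • base hL) = lengthDist α L g h := by
  rw [dist_smul_base, smul_base]
  rfl

theorem spannedSubtree_orbit_base (hL : IsAffineLyndonLength α L) :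
    (metric hL.isHypPseudoMetric).spannedSubtree (MulAction.orbit G (base hL)) = Set.univ := by
  refine Set.eq_univ_of_forall fun p => ?_
  rintro B ⟨hB, hBx⟩
  obtain ⟨a, b, h⟩ := p.2.exists_add_eq
  refine hB _ (hBx ⟨a, rfl⟩) _ (hBx ⟨b, rfl⟩) _
    ((isTree hL.isHypPseudoMetric).isSegment_between (a • base hL) (b • base hL)) ?_
  change _ + _ = _
  rw [LambdaMetric.dist_comm, dist_smul_base, dist_smul_base, dist_smul_base_smul_base, h]

end Hull

/-! ### The universal property -/

section Universal

open LambdaMetric Hull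

variable {Z : Type*} [MulAction G Z] {e : LambdaMetric Λ Z} {z : Z}

/-- Points of a tree at the distances from the orbit of `z` prescribed by a point of the hull. -/
theorem Hull.exists_point (he : e.IsTree) (hα : e.IsAffineAction α)
    (p : Hull (lengthDist α (e.basedLength G z))) : ∃ q, ∀ g : G, e.dist q (g • z) = p.1 g := by
  have hL := he.isAffineLyndonLength hα z
  obtain ⟨a, b, h⟩ := p.2.exists_add_eq
  have ha := p.2.nonneg hL.isHypPseudoMetric a
  have hb := p.2.nonneg hL.isHypPseudoMetric b
  rw [lengthDist_basedLength hα] at h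
  have hS := he.isSegment_between (a • z) (b • z)
  -- The distances to `a • z` and `b • z` fix `q`; hyperbolicity forces all the others.
  obtain ⟨q, -, hq, hq'⟩ := hS.exists_dist_eq hS.left_mem hS.right_mem ha (by grind)
  refine ⟨q, fun c => ?_⟩
  have h1 := p.2.fourPoint a b c
  have h2 := p.2.le_add a c
  have h3 := p.2.le_add b c
  simp only [lengthDist_basedLength hα] at h1 h2 h3
  have h4 := he.fourPoint q (c • z) (a • z) (b • z)
  have := e.dist_triangle (a • z) q (c • z)
  have := e.dist_triangle (b • z) q (c • z)
  have := e.dist_comm (a • z) q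
  have := e.dist_comm (b • z) q
  have := e.dist_comm (a • z) (c • z)
  have := e.dist_comm (b • z) (c • z)
  unfold Between at hq
  grind

theorem LambdaMetric.FourPoint.eq_of_dist_smul_eq (he : e.FourPoint) (hα : e.IsAffineAction α)
    (p : Hull (lengthDist α (e.basedLength G z))) {q r : Z}
    (hq : ∀ g : G, e.dist q (g • z) = p.1 g) (hr : ∀ g : G, e.dist r (g • z) = p.1 g) : q = r := by
  obtain ⟨a, b, h⟩ := p.2.exists_add_eq
  rw [lengthDist_basedLength hα] at h
  refine he.eq_of_between (x := a • z) (y := b • z) ?_ ?_ ?_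
  · rw [Between, e.dist_comm, hq, hq, h]
  · rw [Between, e.dist_comm, hr, hr, h]
  · rw [e.dist_comm, hq, e.dist_comm, hr]

/-- The four-point condition for `q, q', a • z, b • z` gives the upper bound, the triangle
inequality the lower. -/
theorem Hull.dist_eq_of_dist_smul_eq (he : e.FourPoint) (hα : e.IsAffineAction α)
    (p p' : Hull (lengthDist α (e.basedLength G z))) {q q' : Z}
    (hq : ∀ g : G, e.dist q (g • z) = p.1 g) (hq' : ∀ g : G, e.dist q' (g • z) = p'.1 g) :
    e.dist q q' = hdist p p' := by
  obtain ⟨a, b, h⟩ := p.2.exists_add_eq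
  rw [hdist_eq_max p p' h]
  rw [lengthDist_basedLength hα] at h
  have := he q q' (a • z) (b • z)
  have := e.dist_triangle q' q (a • z)
  have := e.dist_triangle q' q (b • z)
  have := e.dist_comm q q'
  grind

theorem Hull.exists_unique_map (he : e.IsTree) (hα : e.IsAffineAction α)
    (hL : IsAffineLyndonLength α (e.basedLength G z)) :
    ∃ μ : Hull (lengthDist α (e.basedLength G z)) → Z,
      (IsEquivariantIsometry G (metric hL.isHypPseudoMetric) e μ ∧ μ (base hL) = z) ∧
      Set.range μ = e.spannedSubtree (MulAction.orbit G z) ∧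
      ∀ ν : Hull (lengthDist α (e.basedLength G z)) → Z,
        IsEquivariantIsometry G (metric hL.isHypPseudoMetric) e ν → ν (base hL) = z → ν = μ := by
  choose μ hμ using Hull.exists_point he hα (z := z)
  have hiso : ∀ p q, e.dist (μ p) (μ q) = (metric hL.isHypPseudoMetric).dist p q :=
    fun p q => dist_eq_of_dist_smul_eq he.fourPoint hα p q (hμ p) (hμ q)
  have hbase : ∀ g : G, μ (g • base hL) = g • z := by
    intro g
    refine he.fourPoint.eq_of_dist_smul_eq hα (g • base hL) (hμ _) fun h => ?_
    rw [smul_base]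
    exact (lengthDist_basedLength hα g h).symm
  refine ⟨μ, ⟨⟨hiso, fun g p => ?_⟩, ?_⟩, ?_, ?_⟩
  · refine he.fourPoint.eq_of_dist_smul_eq hα (g • p) (hμ _) fun h => ?_
    rw [smul_apply, ← hμ, ← hα, smul_smul, mul_inv_cancel_left]
  · simpa using hbase 1
  · refine Set.Subset.antisymm ?_ ?_
    · rintro _ ⟨p, rfl⟩ B ⟨hB, hBz⟩
      obtain ⟨a, b, h⟩ := p.2.exists_add_eq
      refine hB _ (hBz ⟨a, rfl⟩) _ (hBz ⟨b, rfl⟩) _ (he.isSegment_between (a • z) (b • z)) ?_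
      change _ + _ = _
      rw [e.dist_comm, hμ, hμ, h, lengthDist_basedLength hα]
    · refine Set.sInter_subset_of_mem ⟨?_, ?_⟩
      -- The range is a subtree: `r` is the image of the point of `[p, q]` at the same distance from
      -- `p`.
      · rintro _ ⟨p, rfl⟩ _ ⟨q, rfl⟩ S hS r hr
        have hb := hS.between hr
        have hb' := hb
        unfold Between at hb'
        have h0 := e.dist_nonneg (μ p) r
        have h1 := e.dist_nonneg r (μ q)
        have hT := (isTree hL.isHypPseudoMetric).isSegment_between p q
        obtain ⟨s, hs, -, hs'⟩ := hT.exists_dist_eq hT.left_mem hT.right_mem h0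
          (by rw [← hiso]; grind)
        refine ⟨s, he.fourPoint.eq_of_between (x := μ p) (y := μ q) ?_ hb ?_⟩
        · rw [Between, hiso, hiso, hiso]
          exact hs
        · rw [hiso, hs']
      · rintro _ ⟨g, rfl⟩
        exact ⟨_, hbase g⟩
  · intro ν hν hνz
    funext p
    refine he.fourPoint.eq_of_dist_smul_eq hα p (fun g => ?_) (hμ p)
    have hg : ν (g • base hL) = g • z := by rw [hν.map_smul, hνz]
    rw [← hg, hν.dist_map, dist_smul_base]

end Universal

end Lyndon

theorem mainTheorem1 {G : Type u} {Λ : Type v} [Group G] [AddCommGroup Λ]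
    [LinearOrder Λ] [IsOrderedAddMonoid Λ] (α : G →* OrderAddAut Λ) :
    (∀ (X : Type w) [MulAction G X] (d : LambdaMetric Λ X), d.IsTree → d.IsAffineAction α →
      ∀ x : X, IsAffineLyndonLength α (d.basedLength G x)) ∧
    (∀ L : G → Λ, IsAffineLyndonLength α L →
      ∃ (X : Type (max u v)) (_ : MulAction G X) (d : LambdaMetric Λ X) (x : X),
        d.IsTree ∧ d.IsAffineAction α ∧ L = d.basedLength G x ∧
        d.spannedSubtree (MulAction.orbit G x) = Set.univ ∧
        ∀ (Z : Type w) [MulAction G Z] (e : LambdaMetric Λ Z) (z : Z),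
          e.IsTree → e.IsAffineAction α → L = e.basedLength G z →
          ∃ μ : X → Z,
            (LambdaMetric.IsEquivariantIsometry G d e μ ∧ μ x = z) ∧
            Set.range μ = e.spannedSubtree (MulAction.orbit G z) ∧
            ∀ ν : X → Z, LambdaMetric.IsEquivariantIsometry G d e ν → ν x = z → ν = μ) := by
  refine ⟨fun X _ d hd hα x => hd.isAffineLyndonLength hα x, fun L hL => ?_⟩
  refine ⟨Hull (lengthDist α L), Hull.mulAction α L, Hull.metric hL.isHypPseudoMetric,
    Hull.base hL, Hull.isTree _, Hull.isAffineAction hL, (Hull.basedLength_base hL).symm,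
    Hull.spannedSubtree_orbit_base hL, ?_⟩
  intro Z _ e z he hα hLz
  subst hLz
  exact Hull.exists_unique_map he hα hL
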